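/- Let $m\ge 3$ and let $U\subset\mathbb R^m$ be a nonempty connected open set. Let $u,v\in C^2(U)$ be real valued and let $\vec F$ be a $C^1$ vector field on $U$ such that $\nabla u+\vec F\ne 0$ and $\nabla v+\vec F\neq 0$ at every point of $U$. For $w\in\{u,v\}$ put $$N_{\vec F}(w)=\frac{\nabla w+\vec F}{|\nabla w+\vec F|},\qquad H_{\vec F}(w)=\operatorname{div}N_{\vec F}(w).$$ For $C^1$ vector fields $X_1,\dots,X_r$ on $U$ let $\mathcal L(X_1,\dots,X_r)$ be the smallest $C^\infty(U)$-module of vector fields on $U$ that contains $X_1,\dots,X_r$ and contains $[Z,W]$ whenever it contains $Z$ and $W$ and both are of class $C^1$ (if the $X_i$ are $C^\infty$, this is the smallest $C^\infty(U)$-module that contains them and is closed under the Lie bracket). Its rank at $q\in U$ is the dimension of the linear span of all vectors $Z(q)$, $Z\in\mathcal L(X_1,\dots,X_r)$. Suppose that $H_{\vec F}(v)\le H_{\vec F}(u)$ and $v\ge u$ in $U$, and that $v(p_0)=u(p_0)$ for some $p_0\in U$. Suppose that, for $w=u$ or for $w=v$, there are $C^1$ vector fields $N_1^\perp,\dots,N_{m-1}^\perp$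 on $U$ which at every point $x$ of $U$ form an orthonormal basis of the orthogonal complement of $N_{\vec F}(w)(x)$, and such that $\mathcal L(N_1^\perp,\dots,N_{m-1}^\perp)$ has rank $m$ at every point of $U$. Then $v\equiv u$ in $U$. -/

import Mathlib

open scoped ContDiff

noncomputable section

namespace HorizontalCurvature

/-- The Euclidean space of dimension `m`. -/
abbrev E (m : ℕ) : Type := EuclideanSpace ℝ (Fin m)

/-- The divergence of a vector field on Euclidean space at `x`: the sum of the `∂ᵢ Wⁱ (x)`. -/
def divergence {m : ℕ} (W : E m → E m) (x : E m) : ℝ :=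
  ∑ i : Fin m, (fderiv ℝ W x (EuclideanSpace.single i 1)) i

/-- The point `x` is nonsingular for `u`: `∇u + F ≠ 0` at `x`. -/
def Nonsingular {m : ℕ} (F : E m → E m) (u : E m → ℝ) (x : E m) : Prop :=
  gradient u x + F x ≠ 0

/-- The horizontal normal `N_F(u) = (∇u + F) / |∇u + F|`. -/
def horizontalNormal {m : ℕ} (F : E m → E m) (u : E m → ℝ) (x : E m) : E m :=
  ‖gradient u x + F x‖⁻¹ • (gradient u x + F x)

/-- The horizontal mean curvature `H_F(u) = div N_F(u)`. -/
def horizontalMeanCurvature {m : ℕ} (F : E m → E m) (u : E m → ℝ) (x : E m) : ℝ :=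
  divergence (horizontalNormal F u) x

/-- Membership in the Lie span of the vector fields `X i` on the open set `U`: the smallest
module over the smooth functions on `U` that contains the `X i` and is closed under the Lie
bracket. The bracket of two members is taken whenever both are of class `C^1` on `U`; if the
`X i` are smooth on `U`, then all members are, and this is no restriction. Only the values on
`U` matter. -/
inductive LieSpan {m : ℕ} {ι : Type} (U : Set (E m)) (X : ι → E m → E m) :
    (E m → E m) → Prop
  | gen (i : ι) : LieSpan U X (X i)
  | zero : LieSpan U X 0
  | add {Z W : E m → E m} : LieSpan U X Z → LieSpan U X W → LieSpan U X (Z + W)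
  | smul {c : E m → ℝ} {Z : E m → E m} :
      ContDiffOn ℝ ∞ c U → LieSpan U X Z → LieSpan U X (fun x => c x • Z x)
  | bracket {Z W : E m → E m} :
      ContDiffOn ℝ 1 Z U → ContDiffOn ℝ 1 W U → LieSpan U X Z → LieSpan U X W →
      LieSpan U X (VectorField.lieBracket ℝ Z W)

/-- The rank of the Lie span at `q`: the dimension of the space of all values `Z q` of its
members `Z`. -/
def lieRank {m : ℕ} {ι : Type} (U : Set (E m)) (X : ι → E m → E m) (q : E m) : ℕ :=
  Module.finrank ℝ (Submodule.span ℝ {z : E m | ∃ Z : E m → E m, LieSpan U X Z ∧ Z q = z})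

/-- The `X α` form a `C^1` orthonormal frame on `U` of the hyperplane field perpendicular to
the vector field `N`. -/
def IsOrthonormalFramePerp {m : ℕ} (U : Set (E m)) (N : E m → E m)
    (X : Fin (m - 1) → E m → E m) : Prop :=
  (∀ α, ContDiffOn ℝ 1 (X α) U) ∧
  ∀ x ∈ U, Orthonormal ℝ (fun α => X α x) ∧
    Submodule.span ℝ (Set.range fun α => X α x) = (Submodule.span ℝ {N x})ᗮ

/-- On `U` there is an orthonormal frame of the hyperplane field perpendicular to `N_F(u)`
whose Lie span has constant rank `m`. -/
def HasFullRankNormalFrame {m : ℕ} (U : Set (E m)) (F : E m → E m) (u : E m → ℝ) : Prop :=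
  ∃ X : Fin (m - 1) → E m → E m,
    IsOrthonormalFramePerp U (horizontalNormal F u) X ∧ ∀ q ∈ U, lieRank U X q = m

end HorizontalCurvature

end

/-!
The difference `v - u ≥ 0` attains its minimum along the contact set `C = {u = v}`, so there the
gradients of `u` and `v` agree. The mean curvature is the trace of the derivative of `∇w + F` along
the horizontal hyperplane, up to a factor, and depends in a Lipschitz way on the value of `∇w + F`.
Hence the curvature inequality becomes, near a contact point, the linear degenerate elliptic
inequality `∑ᵢ Hess (v - u) (Xᵢ, Xᵢ) ≤ K |∇(v - u)|` for the frame `Xᵢ`.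

Hopf's comparison argument with a Gaussian bump shows that every `Xᵢ` is perpendicular to the
proximal normals of `C`, which is Bony's notion of tangency. By Grönwall's inequality for the
squared distance to `C`, moving along an approximate flow of a tangent field keeps a second-order
tangent parabola of `C` second-order tangent. Following `X`, `Y`, `-X`, `-Y` in turn produces a
parabola with velocity `0` and acceleration `[X, Y]`, so Lie brackets of `C¹` tangent fields are
tangent. Under the rank condition `C` therefore has no proximal normals inside `U`, which makes it
open in `U`; by connectedness it contains `U`.
-/

namespace HorizontalCurvature

open Metric Set Filter Topology Asymptotics
open scoped NNReal

section Tangency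

variable {V : Type*} [NormedAddCommGroup V] [InnerProductSpace ℝ V] {U C : Set V} {X Y : V → V}

/-- Bony's notion of tangency: inside `U`, the field `X` is perpendicular to every proximal normal
`y - z` of `C`, where `z` is a point of `C` nearest to `y`. Only the normals realised by a ball
whose closure lies in `U` are tested, so that `C` and `X` matter on `U` alone. -/
def IsTangentTo (U C : Set V) (X : V → V) : Prop :=
  ∀ z ∈ C, ∀ y, closedBall y (dist y z) ⊆ U → infDist y C = dist y z → inner ℝ (X z) (y - z) = 0

theorem IsTangentTo.zero (U C : Set V) : IsTangentTo U C 0 := fun _ _ _ _ _ => inner_zero_left _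

theorem IsTangentTo.add (hX : IsTangentTo U C X) (hY : IsTangentTo U C Y) :
    IsTangentTo U C (X + Y) := fun z hz y hyU hy => by
  rw [Pi.add_apply, inner_add_left, hX z hz y hyU hy, hY z hz y hyU hy, add_zero]

theorem IsTangentTo.smul (hX : IsTangentTo U C X) (c : V → ℝ) :
    IsTangentTo U C (fun x => c x • X x) := fun z hz y hyU hy => by
  rw [real_inner_smul_left, hX z hz y hyU hy, mul_zero]

theorem IsTangentTo.neg (hX : IsTangentTo U C X) : IsTangentTo U C (-X) := by
  simpa [Pi.neg_def] using hX.smul fun _ => -1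

theorem exists_nearest_closedBall_subset {α : Type*} [PseudoMetricSpace α] [ProperSpace α]
    {C : Set α} (hC : IsClosed C) {x₀ y : α} {ρ : ℝ} (hx₀ : x₀ ∈ C)
    (hy : y ∈ closedBall x₀ (ρ / 2)) :
    ∃ z ∈ C, infDist y C = dist y z ∧ closedBall y (dist y z) ⊆ closedBall x₀ ρ := by
  obtain ⟨z, hz, hyz⟩ := hC.exists_infDist_eq_dist ⟨x₀, hx₀⟩ y
  have hle : dist y z ≤ dist y x₀ := hyz ▸ infDist_le_dist_of_mem hx₀
  exact ⟨z, hz, hyz, closedBall_subset_closedBall' (by linarith [mem_closedBall.1 hy])⟩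

theorem IsTangentTo.two_mul_inner_le (hX : IsTangentTo U C X) {K : ℝ≥0} {y z w : V} {ε : ℝ}
    (hL : LipschitzOnWith K X (closedBall y (dist y z))) (hz : z ∈ C)
    (hyU : closedBall y (dist y z) ⊆ U) (hy : infDist y C = dist y z) (hw : ‖w - X y‖ ≤ ε) :
    2 * inner ℝ (y - z) w ≤ (2 * K + 1) * infDist y C ^ 2 + ε ^ 2 := by
  have hperp : inner ℝ (y - z) (X z) = 0 := by rw [real_inner_comm]; exact hX z hz y hyU hy
  have hsplit : inner ℝ (y - z) w
      = inner ℝ (y - z) (w - X y) + inner ℝ (y - z) (X y - X z) := by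
    simp only [inner_sub_right, hperp]; ring
  have herror : inner ℝ (y - z) (w - X y) ≤ ‖y - z‖ * ε :=
    (real_inner_le_norm _ _).trans (by gcongr)
  have hlip : inner ℝ (y - z) (X y - X z) ≤ ‖y - z‖ * (K * ‖y - z‖) :=
    (real_inner_le_norm _ _).trans (by
      gcongr
      exact hL.norm_sub_le (mem_closedBall_self dist_nonneg) (mem_closedBall'.2 le_rfl))
  rw [hy, dist_eq_norm, hsplit]
  nlinarith [sq_nonneg (‖y - z‖ - ε)]

theorem frequently_slope_infDist_sq_lt {γ : ℝ → V} {w z : V} {t r : ℝ} (hγ : HasDerivAt γ w t)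
    (hz : z ∈ C) (hd : infDist (γ t) C = dist (γ t) z) (hr : 2 * inner ℝ (γ t - z) w < r) :
    ∃ᶠ s in 𝓝[>] t, (s - t)⁻¹ * (infDist (γ s) C ^ 2 - infDist (γ t) C ^ 2) < r := by
  have hderiv : HasDerivAt (fun s => ‖γ s - z‖ ^ 2) (2 * inner ℝ (γ t - z) w) t :=
    (hγ.sub_const z).norm_sq
  refine Eventually.frequently ?_
  filter_upwards [hderiv.hasDerivWithinAt.limsup_slope_le' (s := Ioi t) self_notMem_Ioi hr,
    self_mem_nhdsWithin] with s hs hst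
  refine lt_of_le_of_lt ?_ hs
  have : 0 < s - t := sub_pos.2 hst
  rw [slope_def_module, smul_eq_mul, hd, dist_eq_norm]
  gcongr
  · exact infDist_nonneg
  · rw [← dist_eq_norm]
    exact infDist_le_dist_of_mem hz

theorem gronwallBound_le {δ K ε x : ℝ} (hK : 1 ≤ K) (hε : 0 ≤ ε) :
    gronwallBound δ K ε x ≤ (δ + ε) * Real.exp (K * x) := by
  have hquot : ε / K ≤ ε := div_le_self hε hK
  have hquot0 : 0 ≤ ε / K := by positivity
  rw [gronwallBound_of_K_ne_0 (by positivity)]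
  nlinarith [Real.exp_pos (K * x)]

theorem IsTangentTo.infDist_sq_le [ProperSpace V] (hC : IsClosed C) (hX : IsTangentTo U C X)
    {x₀ : V} {ρ ε : ℝ} {K : ℝ≥0} (hx₀ : x₀ ∈ C) (hU : closedBall x₀ ρ ⊆ U)
    (hL : LipschitzOnWith K X (closedBall x₀ ρ)) {γ γ' : ℝ → V}
    (hγ : ∀ t ∈ Icc (0 : ℝ) 1, HasDerivAt γ (γ' t) t)
    (hε : ∀ t ∈ Icc (0 : ℝ) 1, ‖γ' t - X (γ t)‖ ≤ ε)
    (hmem : ∀ t ∈ Icc (0 : ℝ) 1, γ t ∈ closedBall x₀ (ρ / 2)) :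
    infDist (γ 1) C ^ 2 ≤ (infDist (γ 0) C ^ 2 + ε ^ 2) * Real.exp (2 * K + 1) := by
  have hcont : ContinuousOn (fun t => infDist (γ t) C ^ 2) (Icc 0 1) :=
    ((continuous_infDist_pt C).comp_continuousOn
      fun t ht => (hγ t ht).continuousAt.continuousWithinAt).pow 2
  have hgrowth : ∀ t ∈ Ico (0 : ℝ) 1, ∀ r, (2 * K + 1) * infDist (γ t) C ^ 2 + ε ^ 2 < r →
      ∃ᶠ s in 𝓝[>] t, (s - t)⁻¹ * (infDist (γ s) C ^ 2 - infDist (γ t) C ^ 2) < r := by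
    intro t ht r hr
    have ht' := Ico_subset_Icc_self ht
    obtain ⟨z, hz, hd, hball⟩ := exists_nearest_closedBall_subset hC hx₀ (hmem t ht')
    exact frequently_slope_infDist_sq_lt (hγ t ht') hz hd
      ((hX.two_mul_inner_le (hL.mono hball) hz (hball.trans hU) hd (hε t ht')).trans_lt hr)
  have hbound := le_gronwallBound_of_liminf_deriv_right_le hcont hgrowth le_rfl
    (fun _ _ => le_rfl) 1 (right_mem_Icc.2 zero_le_one)
  simpa using hbound.trans (gronwallBound_le (by simp) (sq_nonneg ε))

/-- `b` is a second-order tangent vector of `C` at `x₀` in the direction `a`: the parabola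
`x₀ + s a + s² b` stays within `o(s²)` of `C` as `s → 0+`. For `C = ∅` the convention
`infDist x ∅ = 0` makes this hold trivially. -/
def IsSecondOrderTangent (C : Set V) (x₀ a b : V) : Prop :=
  (fun s : ℝ => infDist (x₀ + s • a + s ^ 2 • b) C) =o[𝓝[>] 0] fun s => s ^ 2

theorem IsSecondOrderTangent.zero {x₀ : V} (hx₀ : x₀ ∈ C) : IsSecondOrderTangent C x₀ 0 0 := by
  simp [IsSecondOrderTangent, infDist_zero_of_mem hx₀]

theorem eventually_norm_le_of_hasFDerivAt {W W' : Type*} [NormedAddCommGroup W] [NormedSpace ℝ W]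
    [NormedAddCommGroup W'] [NormedSpace ℝ W'] {f : W → W'} {D : W →L[ℝ] W'} {x₀ : W}
    (hf : HasFDerivAt f D x₀) (R : ℝ) {η : ℝ} (hη : 0 < η) :
    ∀ᶠ s in 𝓝 (0 : ℝ), ∀ p : W, ‖p‖ ≤ R → ‖f (x₀ + s • p) - f x₀ - s • D p‖ ≤ η * |s| := by
  have hR : 0 < |R| + 1 := by positivity
  obtain ⟨δ, hδ, hsmall⟩ := Metric.eventually_nhds_iff.1
    (isLittleO_iff.1 hf.isLittleO (div_pos hη hR))
  filter_upwards [Metric.ball_mem_nhds 0 (div_pos hδ hR)] with s hs p hp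
  rw [mem_ball_zero_iff, Real.norm_eq_abs, lt_div_iff₀ hR] at hs
  have hp' : ‖p‖ ≤ |R| + 1 := by linarith [le_abs_self R]
  have hsp : ‖s • p‖ ≤ |s| * (|R| + 1) := by rw [norm_smul, Real.norm_eq_abs]; gcongr
  have hclose : dist (x₀ + s • p) x₀ < δ := by
    rw [dist_eq_norm, add_sub_cancel_left]; exact hsp.trans_lt hs
  calc ‖f (x₀ + s • p) - f x₀ - s • D p‖
      ≤ η / (|R| + 1) * ‖s • p‖ := by simpa using hsmall hclose
    _ ≤ η / (|R| + 1) * (|s| * (|R| + 1)) := by gcongr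
    _ = η * |s| := by field_simp

/-- The path `τ ↦ x₀ + s (a + τ X₀) + s² (b + τ D a + τ² D X₀ / 2)` which follows, for time `s` and
up to `o(s²)`, the flow of a field with value `X₀` and derivative `D` at `x₀`, starting from
`x₀ + s a + s² b`. -/
noncomputable def approxFlow (D : V →L[ℝ] V) (x₀ X₀ a b : V) (s τ : ℝ) : V :=
  x₀ + s • (a + τ • X₀) + s ^ 2 • (b + τ • D a + (τ ^ 2 / 2) • D X₀)

theorem hasDerivAt_approxFlow (D : V →L[ℝ] V) (x₀ X₀ a b : V) (s τ : ℝ) :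
    HasDerivAt (approxFlow D x₀ X₀ a b s) (s • X₀ + s ^ 2 • (D a + τ • D X₀)) τ := by
  have hlin : HasDerivAt (fun τ : ℝ => a + τ • X₀) X₀ τ := by
    simpa using ((hasDerivAt_id τ).smul_const X₀).const_add a
  have hquad : HasDerivAt (fun τ : ℝ => b + τ • D a + (τ ^ 2 / 2) • D X₀) (D a + τ • D X₀) τ := by
    have hsq : HasDerivAt (fun τ : ℝ => τ ^ 2 / 2) τ τ := by
      simpa using ((hasDerivAt_id τ).pow 2).div_const 2
    simpa using (((hasDerivAt_id τ).smul_const (D a)).const_add b).fun_add (hsq.smul_const (D X₀))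
  exact ((hlin.const_smul s).const_add x₀).add (hquad.const_smul (s ^ 2))

theorem eventually_approxFlow_mem_closedBall (D : V →L[ℝ] V) (x₀ X₀ a b : V) {ρ : ℝ} (hρ : 0 < ρ) :
    ∀ᶠ s in 𝓝 0, ∀ τ ∈ Icc (0 : ℝ) 1, approxFlow D x₀ X₀ a b s τ ∈ closedBall x₀ ρ := by
  have hcont : Continuous fun q : ℝ × ℝ => approxFlow D x₀ X₀ a b q.1 q.2 := by
    unfold approxFlow; fun_prop
  refine isCompact_Icc.eventually_forall_of_forall_eventually fun τ _ =>
    hcont.continuousAt.eventually_mem ?_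
  simpa [approxFlow] using closedBall_mem_nhds x₀ hρ

theorem eventually_approxFlow_deriv_sub_le {X : V → V} {D : V →L[ℝ] V} {x₀ : V}
    (hX : HasFDerivAt X D x₀) (a b : V) {η : ℝ} (hη : 0 < η) :
    ∀ᶠ s in 𝓝 0, ∀ τ ∈ Icc (0 : ℝ) 1,
      ‖s • X x₀ + s ^ 2 • (D a + τ • D (X x₀)) - s • X (approxFlow D x₀ (X x₀) a b s τ)‖
        ≤ η * s ^ 2 := by
  set q : ℝ → V := fun τ => b + τ • D a + (τ ^ 2 / 2) • D (X x₀)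
  obtain ⟨R, hR⟩ := (isCompact_Icc.prod isCompact_Icc).exists_bound_of_continuousOn
    (s := Icc (-1 : ℝ) 1 ×ˢ Icc (0 : ℝ) 1) (f := fun r => a + r.2 • X x₀ + r.1 • q r.2)
    (by fun_prop)
  obtain ⟨Q, hQ⟩ := isCompact_Icc.exists_bound_of_continuousOn (s := Icc (0 : ℝ) 1)
    (f := q) (by fun_prop)
  have hsmall : ∀ᶠ s in 𝓝 (0 : ℝ), |s| * (‖D‖ * Q) < η / 2 :=
    (show Continuous fun s : ℝ => |s| * (‖D‖ * Q) by fun_prop).continuousAt.eventually_lt_const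
      (by simpa using half_pos hη)
  have habs : ∀ᶠ s in 𝓝 (0 : ℝ), |s| < 1 :=
    continuous_abs.continuousAt.eventually_lt_const (by simp)
  filter_upwards [eventually_norm_le_of_hasFDerivAt hX R (half_pos hη), hsmall, habs]
    with s hexp hs hs1 τ hτ
  set p : V := a + τ • X x₀ + s • q τ
  have hp : ‖p‖ ≤ R := hR (s, τ) ⟨abs_le.1 hs1.le, hτ⟩
  have hflow : approxFlow D x₀ (X x₀) a b s τ = x₀ + s • p := by
    simp only [approxFlow, p, q]; module
  have hsplit : s • X x₀ + s ^ 2 • (D a + τ • D (X x₀)) - s • X (x₀ + s • p)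
      = -(s • (X (x₀ + s • p) - X x₀ - s • D p)) - (s ^ 2 * s) • D (q τ) := by
    simp only [p, map_add, map_smul]; module
  have hrem : ‖(s ^ 2 * s) • D (q τ)‖ ≤ s ^ 2 * (|s| * (‖D‖ * Q)) := by
    rw [norm_smul, norm_mul, Real.norm_eq_abs, Real.norm_eq_abs, abs_of_nonneg (sq_nonneg s),
      mul_assoc]
    gcongr
    exact D.le_opNorm_of_le (hQ τ hτ)
  have hmain : ‖s • (X (x₀ + s • p) - X x₀ - s • D p)‖ ≤ |s| * (η / 2 * |s|) := by
    rw [norm_smul, Real.norm_eq_abs]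
    gcongr
    exact hexp p hp
  rw [hflow, hsplit]
  refine (norm_sub_le _ _).trans ?_
  rw [norm_neg]
  nlinarith [abs_mul_abs_self s, sq_nonneg s]

theorem IsTangentTo.eventually_infDist_approxFlow_le [ProperSpace V] (hC : IsClosed C)
    (hX : IsTangentTo U C X) (hU : IsOpen U) {x₀ a b : V} (hx₀ : x₀ ∈ C) (hx₀U : x₀ ∈ U)
    (hX₁ : ContDiffAt ℝ 1 X x₀) :
    ∃ M : ℝ, ∀ η > 0, ∀ᶠ s in 𝓝[>] (0 : ℝ),
      infDist (approxFlow (fderiv ℝ X x₀) x₀ (X x₀) a b s 1) C ^ 2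
        ≤ (infDist (approxFlow (fderiv ℝ X x₀) x₀ (X x₀) a b s 0) C ^ 2 + (η * s ^ 2) ^ 2) * M := by
  obtain ⟨K, t, ht, hL⟩ := hX₁.exists_lipschitzOnWith
  obtain ⟨ρ, hρ, hball⟩ := nhds_basis_closedBall.mem_iff.1 (inter_mem ht (hU.mem_nhds hx₀U))
  refine ⟨Real.exp (2 * K + 1), fun η hη => ?_⟩
  have hD := (hX₁.differentiableAt one_ne_zero).hasFDerivAt
  filter_upwards [self_mem_nhdsWithin, nhdsWithin_le_nhds (gt_mem_nhds one_pos),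
    nhdsWithin_le_nhds (eventually_approxFlow_mem_closedBall _ x₀ (X x₀) a b (half_pos hρ)),
    nhdsWithin_le_nhds (eventually_approxFlow_deriv_sub_le hD a b hη)] with s hs0 hs1 hmem hderiv
  have hLs : LipschitzOnWith K (fun x => s • X x) (closedBall x₀ ρ) := by
    refine LipschitzOnWith.of_dist_le_mul fun x hx y hy => ?_
    rw [dist_smul₀, Real.norm_of_nonneg (le_of_lt hs0)]
    exact (mul_le_of_le_one_left dist_nonneg hs1.le).trans
      (hL.dist_le_mul x (hball hx).1 y (hball hy).1)
  exact (hX.smul fun _ => s).infDist_sq_le hC hx₀ (hball.trans inter_subset_right) hLs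
    (fun τ _ => hasDerivAt_approxFlow _ _ _ _ _ s τ) hderiv hmem

theorem IsTangentTo.isSecondOrderTangent_add [ProperSpace V] (hC : IsClosed C)
    (hX : IsTangentTo U C X) (hU : IsOpen U) {x₀ a b : V} (hx₀ : x₀ ∈ C) (hx₀U : x₀ ∈ U)
    (hX₁ : ContDiffAt ℝ 1 X x₀) (hab : IsSecondOrderTangent C x₀ a b) :
    IsSecondOrderTangent C x₀ (a + X x₀)
      (b + fderiv ℝ X x₀ a + (1 / 2 : ℝ) • fderiv ℝ X x₀ (X x₀)) := by
  obtain ⟨M, hM⟩ := hX.eventually_infDist_approxFlow_le hC hU (a := a) (b := b) hx₀ hx₀U hX₁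
  refine isLittleO_iff.2 fun c hc => ?_
  set η := c / √(2 * (|M| + 1))
  have hη : 0 < η := by positivity
  have hη_sq : 2 * η ^ 2 * (|M| + 1) = c ^ 2 := by
    simp only [η, div_pow, Real.sq_sqrt (by positivity : 0 ≤ 2 * (|M| + 1))]
    field_simp
  filter_upwards [isLittleO_iff.1 hab hη, hM η hη] with s hstart hflow
  simp only [Real.norm_of_nonneg infDist_nonneg, Real.norm_of_nonneg (sq_nonneg s)] at hstart ⊢
  simp only [approxFlow, one_smul, one_pow, zero_smul, add_zero, ne_eq, OfNat.ofNat_ne_zero,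
    not_false_eq_true, zero_pow, zero_div] at hflow
  refine (sq_le_sq₀ infDist_nonneg (by positivity)).1 ?_
  calc _ ≤ _ := hflow
    _ ≤ (infDist (x₀ + s • a + s ^ 2 • b) C ^ 2 + (η * s ^ 2) ^ 2) * (|M| + 1) := by
      gcongr
      linarith [le_abs_self M]
    _ ≤ ((η * s ^ 2) ^ 2 + (η * s ^ 2) ^ 2) * (|M| + 1) := by
      gcongr
      exact infDist_nonneg
    _ = (c * s ^ 2) ^ 2 := by rw [mul_pow c, ← hη_sq]; ring

theorem IsSecondOrderTangent.inner_nonpos {x₀ w y : V} (hw : IsSecondOrderTangent C x₀ 0 w)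
    (hy : infDist y C = dist y x₀) : inner ℝ (y - x₀) w ≤ 0 := by
  set n := y - x₀
  set d : ℝ → ℝ := fun s => infDist (x₀ + s ^ 2 • w) C
  have hd : d =o[𝓝[>] 0] fun s => s ^ 2 := by simpa [IsSecondOrderTangent] using hw
  have hsep (s : ℝ) : ‖n‖ ≤ ‖n - s ^ 2 • w‖ + d s := by
    have h := infDist_le_infDist_add_dist (s := C) (x := y) (y := x₀ + s ^ 2 • w)
    rwa [hy, dist_eq_norm, dist_eq_norm, add_comm, ← sub_sub] at h
  have hquot : ∀ᶠ s in 𝓝[>] (0 : ℝ),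
      2 * inner ℝ n w ≤ s ^ 2 * ‖w‖ ^ 2 + 2 * ‖n‖ * (d s / s ^ 2) := by
    filter_upwards [self_mem_nhdsWithin] with s hs
    have hs2 : 0 < s ^ 2 := pow_pos hs 2
    have hexp : ‖n - s ^ 2 • w‖ ^ 2
        = ‖n‖ ^ 2 - 2 * (s ^ 2 * inner ℝ n w) + (s ^ 2) ^ 2 * ‖w‖ ^ 2 := by
      rw [norm_sub_sq_real, real_inner_smul_right, norm_smul, mul_pow, Real.norm_of_nonneg hs2.le]
    have hmul : ‖n‖ ^ 2 ≤ ‖n - s ^ 2 • w‖ ^ 2 + 2 * ‖n‖ * d s := by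
      nlinarith [hsep s, norm_nonneg n, sq_nonneg (‖n‖ - ‖n - s ^ 2 • w‖)]
    refine le_of_mul_le_mul_left ?_ hs2
    calc s ^ 2 * (2 * inner ℝ n w) ≤ (s ^ 2) ^ 2 * ‖w‖ ^ 2 + 2 * ‖n‖ * d s := by linarith
      _ = s ^ 2 * (s ^ 2 * ‖w‖ ^ 2 + 2 * ‖n‖ * (d s / s ^ 2)) := by field_simp [(mem_Ioi.1 hs).ne']
  have hsq : Tendsto (fun s : ℝ => s ^ 2 * ‖w‖ ^ 2) (𝓝[>] 0) (𝓝 0) :=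
    ((show Continuous fun s : ℝ => s ^ 2 * ‖w‖ ^ 2 by fun_prop).tendsto' 0 0
      (by simp)).mono_left nhdsWithin_le_nhds
  have hlim := hsq.add (hd.tendsto_div_nhds_zero.const_mul (2 * ‖n‖))
  rw [mul_zero, add_zero] at hlim
  linarith [ge_of_tendsto hlim hquot]

theorem IsTangentTo.isSecondOrderTangent_lieBracket [ProperSpace V] (hC : IsClosed C)
    (hX : IsTangentTo U C X) (hY : IsTangentTo U C Y) (hU : IsOpen U) {x₀ : V} (hx₀ : x₀ ∈ C)
    (hx₀U : x₀ ∈ U) (hX₁ : ContDiffAt ℝ 1 X x₀) (hY₁ : ContDiffAt ℝ 1 Y x₀) :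
    IsSecondOrderTangent C x₀ 0 (VectorField.lieBracket ℝ X Y x₀) := by
  have hXY := hY.isSecondOrderTangent_add hC hU hx₀ hx₀U hY₁
    (hX.isSecondOrderTangent_add hC hU hx₀ hx₀U hX₁ (.zero hx₀))
  have hcommutator := hY.neg.isSecondOrderTangent_add hC hU hx₀ hx₀U hY₁.neg
    (hX.neg.isSecondOrderTangent_add hC hU hx₀ hx₀U hX₁.neg hXY)
  convert hcommutator using 1 <;>
    simp only [VectorField.lieBracket, fderiv_neg, Pi.neg_apply, neg_apply, map_neg, map_add,
      map_zero] <;> module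

theorem IsTangentTo.lieBracket [ProperSpace V] (hC : IsClosed C) (hX : IsTangentTo U C X)
    (hY : IsTangentTo U C Y) (hU : IsOpen U) (hX₁ : ContDiffOn ℝ 1 X U)
    (hY₁ : ContDiffOn ℝ 1 Y U) : IsTangentTo U C (VectorField.lieBracket ℝ X Y) := by
  intro z hz y hyU hy
  have hzU : z ∈ U := hyU (mem_closedBall'.2 le_rfl)
  have hX₁z := hX₁.contDiffAt (hU.mem_nhds hzU)
  have hY₁z := hY₁.contDiffAt (hU.mem_nhds hzU)
  have hXY := (hX.isSecondOrderTangent_lieBracket hC hY hU hz hzU hX₁z hY₁z).inner_nonpos hy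
  have hYX := (hY.isSecondOrderTangent_lieBracket hC hX hU hz hzU hY₁z hX₁z).inner_nonpos hy
  rw [VectorField.lieBracket_swap, inner_neg_right] at hYX
  rw [real_inner_comm]
  exact le_antisymm hXY (neg_nonpos.1 hYX)

end Tangency

section LieSpan

variable {m : ℕ} {ι : Type} {U C : Set (E m)} {X : ι → E m → E m}

theorem LieSpan.isTangentTo (hU : IsOpen U) (hC : IsClosed C) (hX : ∀ i, IsTangentTo U C (X i))
    {Z : E m → E m} (hZ : LieSpan U X Z) : IsTangentTo U C Z := by
  induction hZ with
  | gen i => exact hX i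
  | zero => exact .zero U C
  | add _ _ hZ hW => exact hZ.add hW
  | smul _ _ hZ => exact hZ.smul _
  | bracket hZ₁ hW₁ _ _ hZ hW => exact hZ.lieBracket hC hW hU hZ₁ hW₁

theorem eq_of_infDist_eq_of_lieRank (hU : IsOpen U) (hC : IsClosed C)
    (hX : ∀ i, IsTangentTo U C (X i)) {y z : E m} (hz : z ∈ C) (hyU : closedBall y (dist y z) ⊆ U)
    (hy : infDist y C = dist y z) (hr : lieRank U X z = m) : y = z := by
  set values : Set (E m) := {w | ∃ Z, LieSpan U X Z ∧ Z z = w}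
  have hspan : Submodule.span ℝ values = ⊤ :=
    Submodule.eq_top_of_finrank_eq (by rw [finrank_euclideanSpace_fin]; exact hr)
  have hortho : Submodule.span ℝ values ⟂ Submodule.span ℝ {y - z} := by
    rw [Submodule.isOrtho_span]
    rintro _ ⟨Z, hZ, rfl⟩ _ rfl
    exact hZ.isTangentTo hU hC hX z hz y hyU hy
  rwa [hspan, Submodule.isOrtho_top_left, Submodule.span_singleton_eq_bot, sub_eq_zero] at hortho

theorem subset_of_isTangentTo_of_lieRank (hU : IsOpen U) (hUc : IsPreconnected U)
    (hC : IsClosed C) (hX : ∀ i, IsTangentTo U C (X i)) (hr : ∀ q ∈ U, lieRank U X q = m)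
    (hne : (U ∩ C).Nonempty) : U ⊆ C := by
  have hinterior : U ∩ C ⊆ interior C := by
    rintro x₀ ⟨hx₀U, hx₀⟩
    obtain ⟨ρ, hρ, hball⟩ := nhds_basis_closedBall.mem_iff.1 (hU.mem_nhds hx₀U)
    refine mem_interior_iff_mem_nhds.2
      (mem_of_superset (closedBall_mem_nhds x₀ (half_pos hρ)) fun y hy => ?_)
    obtain ⟨z, hz, hyz, hsub⟩ := exists_nearest_closedBall_subset hC hx₀ hy
    have hzU : z ∈ U := hball (hsub (mem_closedBall'.2 le_rfl))
    rwa [eq_of_infDist_eq_of_lieRank hU hC hX hz (hsub.trans hball) hyz (hr z hzU)]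
  refine (hUc.subset_of_closure_inter_subset isOpen_interior
    (hne.mono fun x hx => ⟨hx.1, hinterior hx⟩) ?_).trans interior_subset
  rintro x ⟨hx, hxU⟩
  exact hinterior ⟨hxU, closure_minimal interior_subset hC hx⟩

end LieSpan

section Hopf

theorem deriv_deriv_nonneg_of_isLocalMin {g : ℝ → ℝ} {t : ℝ} (h : IsLocalMin g t)
    (hg : ContinuousAt g t) : 0 ≤ deriv (deriv g) t := by
  by_contra! hneg
  have hmax := isLocalMax_of_deriv_deriv_neg hneg h.deriv_eq_zero hg
  have hconst : g =ᶠ[𝓝 t] fun _ => g t := by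
    filter_upwards [h, hmax] with s hmin hmax using le_antisymm hmax hmin
  have hzero : deriv (deriv g) t = 0 := by
    rw [hconst.deriv.deriv_eq, deriv_const', deriv_const]
  exact hneg.ne hzero

section NormedSpace

variable {W : Type*} [NormedAddCommGroup W] [NormedSpace ℝ W] {f g : W → ℝ} {x : W}

theorem deriv_deriv_comp_line (hf : ContDiffAt ℝ 2 f x) (w : W) :
    deriv (deriv fun t : ℝ => f (x + t • w)) 0 = fderiv ℝ (fderiv ℝ f) x w w := by
  have hline (t : ℝ) : HasDerivAt (fun t : ℝ => x + t • w) w t := by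
    simpa using ((hasDerivAt_id t).smul_const w).const_add x
  have hlim : Tendsto (fun t : ℝ => x + t • w) (𝓝 0) (𝓝 x) := by
    simpa using (hline 0).continuousAt.tendsto
  have hfirst : (deriv fun t : ℝ => f (x + t • w)) =ᶠ[𝓝 0] fun t => fderiv ℝ f (x + t • w) w := by
    filter_upwards [hlim.eventually (hf.eventually (by simp))] with t ht
    exact ((ht.differentiableAt two_ne_zero).hasFDerivAt.comp_hasDerivAt t (hline t)).deriv
  have hsecond : HasDerivAt (fun t : ℝ => fderiv ℝ f (x + t • w))
      (fderiv ℝ (fderiv ℝ f) x w) 0 := by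
    refine HasFDerivAt.comp_hasDerivAt (0 : ℝ) ?_ (hline 0)
    rw [zero_smul, add_zero]
    exact ((hf.fderiv_right (m := 1) (by norm_num)).differentiableAt one_ne_zero).hasFDerivAt
  rw [hfirst.deriv_eq]
  simpa using (hsecond.clm_apply (hasDerivAt_const 0 w)).deriv

theorem fderiv_fderiv_apply_nonneg_of_isLocalMin (h : IsLocalMin f x) (hf : ContDiffAt ℝ 2 f x)
    (w : W) : 0 ≤ fderiv ℝ (fderiv ℝ f) x w w := by
  have hline : ContinuousAt (fun t : ℝ => x + t • w) 0 := by fun_prop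
  have hx : x + (0 : ℝ) • w = x := by simp
  rw [← deriv_deriv_comp_line hf]
  refine deriv_deriv_nonneg_of_isLocalMin ?_
    (ContinuousAt.comp (by rw [hx]; exact hf.continuousAt) hline)
  exact IsLocalMin.comp_continuous (g := fun t : ℝ => x + t • w) (by rwa [hx]) hline

theorem fderiv_fderiv_sub (hf : ContDiffAt ℝ 2 f x) (hg : ContDiffAt ℝ 2 g x) :
    fderiv ℝ (fderiv ℝ (f - g)) x = fderiv ℝ (fderiv ℝ f) x - fderiv ℝ (fderiv ℝ g) x := by
  have hfirst : fderiv ℝ (f - g) =ᶠ[𝓝 x] fderiv ℝ f - fderiv ℝ g := by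
    filter_upwards [hf.eventually (by simp), hg.eventually (by simp)] with y hfy hgy
    exact fderiv_sub (hfy.differentiableAt two_ne_zero) (hgy.differentiableAt two_ne_zero)
  rw [hfirst.fderiv_eq]
  exact fderiv_sub ((hf.fderiv_right (m := 1) le_rfl).differentiableAt one_ne_zero)
    ((hg.fderiv_right (m := 1) le_rfl).differentiableAt one_ne_zero)

theorem fderiv_fderiv_const_smul (c : ℝ) :
    fderiv ℝ (fderiv ℝ (c • f)) x = c • fderiv ℝ (fderiv ℝ f) x := by
  rw [fderiv_const_smul_field c]
  exact congrFun (fderiv_const_smul_field (𝕜 := ℝ) (f := fderiv ℝ f) c) x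

end NormedSpace

theorem exists_isLocalMin_sub_smul {α : Type*} [PseudoMetricSpace α] [ProperSpace α]
    {f g : α → ℝ} {z : α} {δ : ℝ} (hδ : 0 < δ) (hf : ContinuousOn f (closedBall z δ))
    (hg : ContinuousOn g (closedBall z δ)) (hf₀ : ∀ p ∈ closedBall z δ, 0 ≤ f p) (hfz : f z = 0)
    (hpos : ∀ p ∈ sphere z δ, g z ≤ g p → 0 < f p) :
    ∃ ε > (0 : ℝ), ∃ x ∈ ball z δ, IsLocalMin (f - ε • g) x := by
  set cap : Set α := sphere z δ ∩ g ⁻¹' Ici (g z)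
  have hcap_sub : cap ⊆ closedBall z δ := inter_subset_left.trans sphere_subset_closedBall
  have hcap : IsCompact cap := (isCompact_sphere z δ).of_isClosed_subset
    ((hg.mono sphere_subset_closedBall).preimage_isClosed_of_isClosed isClosed_sphere isClosed_Ici)
    inter_subset_left
  have hden (p : α) (hp : p ∈ cap) : 0 < 1 + (g p - g z) := by linarith [show g z ≤ g p from hp.2]
  obtain ⟨ε, hε, hle⟩ := hcap.exists_forall_le' (f := fun p => f p / (1 + (g p - g z))) (a := 0)
    ((hf.mono hcap_sub).div (by have := hg.mono hcap_sub; fun_prop) fun p hp => (hden p hp).ne')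
    fun p hp => div_pos (hpos p hp.1 hp.2) (hden p hp)
  have hsphere : ∀ p ∈ sphere z δ, (f - ε • g) z < (f - ε • g) p := by
    intro p hp
    simp only [Pi.sub_apply, Pi.smul_apply, smul_eq_mul, hfz]
    rcases le_or_gt (g z) (g p) with hgp | hgp
    · have := (le_div_iff₀ (hden p ⟨hp, hgp⟩)).1 (hle p ⟨hp, hgp⟩)
      linarith
    · nlinarith [hf₀ p (sphere_subset_closedBall hp)]
  obtain ⟨x, hx, hmin⟩ := (isCompact_closedBall z δ).exists_isMinOn
    ⟨z, mem_closedBall_self hδ.le⟩ (hf.sub (hg.const_smul ε))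
  have hxball : x ∈ ball z δ := (mem_closedBall.1 hx).lt_of_ne fun hxδ =>
    (hsphere x hxδ).not_ge (hmin (mem_closedBall_self hδ.le))
  exact ⟨ε, hε, x, hxball, hmin.isLocalMin (closedBall_mem_nhds_of_mem hxball)⟩

variable {V : Type*} [NormedAddCommGroup V]

/-- The radial comparison function `exp (-k |p - c|²)` of Hopf's boundary point lemma. -/
noncomputable def gaussianBump (k : ℝ) (c p : V) : ℝ := Real.exp (-k * ‖p - c‖ ^ 2)

theorem gaussianBump_pos (k : ℝ) (c p : V) : 0 < gaussianBump k c p := Real.exp_pos _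

theorem gaussianBump_le_gaussianBump {k : ℝ} (hk : 0 < k) {c p q : V} :
    gaussianBump k c p ≤ gaussianBump k c q ↔ dist q c ≤ dist p c := by
  rw [gaussianBump, gaussianBump, Real.exp_le_exp, neg_mul, neg_mul, neg_le_neg_iff,
    mul_le_mul_iff_right₀ hk, dist_eq_norm, dist_eq_norm,
    pow_le_pow_iff_left₀ (norm_nonneg _) (norm_nonneg _) two_ne_zero]

variable [InnerProductSpace ℝ V]

theorem contDiff_gaussianBump (k : ℝ) (c : V) {n : ℕ∞} : ContDiff ℝ n (gaussianBump k c) :=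
  Real.contDiff_exp.comp (contDiff_const.mul ((contDiff_id.sub contDiff_const).norm_sq ℝ))

theorem fderiv_gaussianBump (k : ℝ) (c : V) :
    fderiv ℝ (gaussianBump k c) = fun p => (-(2 * k) * gaussianBump k c p) • innerSL ℝ (p - c) := by
  funext p
  have hsq : HasFDerivAt (fun p => ‖p - c‖ ^ 2) _ p := ((hasFDerivAt_id p).sub_const c).norm_sq
  have hexp : HasFDerivAt (gaussianBump k c) _ p := (hsq.const_mul (-k)).exp
  rw [hexp.fderiv]
  ext w
  simp [gaussianBump]
  ring

theorem norm_fderiv_gaussianBump {k : ℝ} (hk : 0 ≤ k) (c p : V) :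
    ‖fderiv ℝ (gaussianBump k c) p‖ = 2 * k * gaussianBump k c p * ‖p - c‖ := by
  rw [fderiv_gaussianBump, norm_smul, innerSL_apply_norm, neg_mul, norm_neg,
    Real.norm_of_nonneg (mul_nonneg (by positivity) (gaussianBump_pos k c p).le)]

theorem fderiv_fderiv_gaussianBump_apply (k : ℝ) (c p w : V) :
    fderiv ℝ (fderiv ℝ (gaussianBump k c)) p w w =
      2 * k * gaussianBump k c p * (2 * k * inner ℝ (p - c) w ^ 2 - ‖w‖ ^ 2) := by
  have hbump := (((contDiff_gaussianBump k c (n := 1)).differentiable one_ne_zero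
    p).hasFDerivAt.const_mul (-(2 * k)))
  have hinner : HasFDerivAt (fun p => innerSL ℝ (p - c)) (innerSL ℝ : V →L[ℝ] V →L[ℝ] ℝ) p :=
    (innerSL ℝ).hasFDerivAt.comp p ((hasFDerivAt_id p).sub_const c)
  have hself : (innerSL ℝ : V →L[ℝ] V →L[ℝ] ℝ) w w = ‖w‖ ^ 2 := real_inner_self_eq_norm_sq w
  rw [fderiv_gaussianBump, (hbump.fun_smul hinner).fderiv, fderiv_gaussianBump]
  simp [hself, inner_sub_left]
  ring

theorem exists_eventually_lt_sum_fderiv_fderiv_gaussianBump {ι : Type*} [Fintype ι]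
    {X : ι → V → V} {z c : V} (hX : ∀ i, ContinuousAt (X i) z) {i : ι}
    (hi : inner ℝ (z - c) (X i z) ≠ 0) (K : ℝ) :
    ∃ k > (0 : ℝ), ∀ᶠ x in 𝓝 z, K * ‖fderiv ℝ (gaussianBump k c) x‖
      < ∑ j, fderiv ℝ (fderiv ℝ (gaussianBump k c)) x (X j x) (X j x) := by
  set S : V → ℝ := fun p => ∑ j, inner ℝ (p - c) (X j p) ^ 2
  set Q : V → ℝ := fun p => ∑ j, ‖X j p‖ ^ 2 + K * ‖p - c‖
  have hSz : 0 < S z :=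
    Finset.sum_pos' (fun j _ => sq_nonneg _) ⟨i, Finset.mem_univ i, sq_pos_of_ne_zero hi⟩
  have hScont : ContinuousAt S z := tendsto_finsetSum _ fun j _ =>
    ((continuousAt_id.sub continuousAt_const).inner (hX j)).pow 2
  have hQcont : ContinuousAt Q z := (tendsto_finsetSum _ fun j _ => (hX j).norm.pow 2).add
    (continuousAt_const.mul (continuousAt_id.sub continuousAt_const).norm)
  set k : ℝ := (|Q z| + 1) / S z
  have hk : 0 < k := by positivity
  have hQz : Q z < 2 * k * S z := by
    have : k * S z = |Q z| + 1 := div_mul_cancel₀ _ hSz.ne'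
    linarith [le_abs_self (Q z), abs_nonneg (Q z)]
  refine ⟨k, hk, (hQcont.eventually_lt (hScont.const_mul _) hQz).mono fun x hx => ?_⟩
  have hfactor : 0 < 2 * k * gaussianBump k c x := mul_pos (by positivity) (gaussianBump_pos k c x)
  simp only [norm_fderiv_gaussianBump hk.le, fderiv_fderiv_gaussianBump_apply, ← Finset.mul_sum,
    Finset.sum_sub_distrib]
  calc K * (2 * k * gaussianBump k c x * ‖x - c‖)
      = 2 * k * gaussianBump k c x * (K * ‖x - c‖) := by ring
    _ < 2 * k * gaussianBump k c x * (2 * k * S x - ∑ j, ‖X j x‖ ^ 2) := by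
      gcongr
      linarith

theorem inner_eq_zero_of_sum_fderiv_fderiv_le [ProperSpace V] {ι : Type*} [Fintype ι]
    {φ : V → ℝ} {X : ι → V → V} {z c : V} (hφ : ContDiffAt ℝ 2 φ z) (hφz : φ z = 0)
    (hφ₀ : ∀ᶠ p in 𝓝 z, 0 ≤ φ p)
    (hφpos : ∀ᶠ p in 𝓝 z, dist p c ≤ dist z c → p ≠ z → 0 < φ p)
    (hX : ∀ i, ContinuousAt (X i) z) {K : ℝ}
    (hK : ∀ᶠ x in 𝓝 z, ∑ i, fderiv ℝ (fderiv ℝ φ) x (X i x) (X i x) ≤ K * ‖fderiv ℝ φ x‖)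
    (i : ι) : inner ℝ (z - c) (X i z) = 0 := by
  by_contra hi
  obtain ⟨k, hk, hstrict⟩ := exists_eventually_lt_sum_fderiv_fderiv_gaussianBump hX hi K
  set h := gaussianBump k c
  have hh : ContDiff ℝ 2 h := contDiff_gaussianBump k c
  obtain ⟨δ, hδ, hball⟩ := nhds_basis_closedBall.eventually_iff.1
    ((hφ.eventually (by simp)).and (hφ₀.and (hφpos.and (hK.and hstrict))))
  obtain ⟨ε, hε, x, hx, hmin⟩ := exists_isLocalMin_sub_smul (g := h) hδ
    (fun p hp => (hball hp).1.continuousAt.continuousWithinAt) hh.continuous.continuousOn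
    (fun p hp => (hball hp).2.1) hφz fun p hp hle =>
      (hball (sphere_subset_closedBall hp)).2.2.1 ((gaussianBump_le_gaussianBump hk).1 hle)
        (ne_of_mem_sphere hp hδ.ne')
  obtain ⟨hφx, -, -, hKx, hstrictx⟩ := hball (ball_subset_closedBall hx)
  have hεh : ContDiffAt ℝ 2 (ε • h) x := (hh.const_smul ε).contDiffAt
  have hgrad : fderiv ℝ φ x = ε • fderiv ℝ h x := by
    have := hmin.fderiv_eq_zero
    rwa [fderiv_sub (hφx.differentiableAt two_ne_zero) (hεh.differentiableAt two_ne_zero),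
      fderiv_const_smul_field, sub_eq_zero] at this
  have hhess (w : V) : ε * fderiv ℝ (fderiv ℝ h) x w w ≤ fderiv ℝ (fderiv ℝ φ) x w w := by
    have := fderiv_fderiv_apply_nonneg_of_isLocalMin hmin (hφx.sub hεh) w
    rw [fderiv_fderiv_sub hφx hεh, fderiv_fderiv_const_smul] at this
    simpa using this
  have : ε * ∑ j, fderiv ℝ (fderiv ℝ h) x (X j x) (X j x) ≤ ε * (K * ‖fderiv ℝ h x‖) :=
    calc _ ≤ ∑ j, fderiv ℝ (fderiv ℝ φ) x (X j x) (X j x) := by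
          rw [Finset.mul_sum]; exact Finset.sum_le_sum fun j _ => hhess _
      _ ≤ K * ‖fderiv ℝ φ x‖ := hKx
      _ = ε * (K * ‖fderiv ℝ h x‖) := by rw [hgrad, norm_smul, Real.norm_of_nonneg hε.le]; ring
  exact (le_of_mul_le_mul_left this hε).not_gt hstrictx

theorem dist_lt_of_mem_closedBall_midpoint {p y z : V}
    (hp : dist p (midpoint ℝ y z) ≤ dist z (midpoint ℝ y z)) (hpz : p ≠ z) :
    dist p y < dist z y := by
  have hmem := combo_mem_ball_of_ne (mem_closedBall.2 hp) (mem_closedBall.2 le_rfl) hpz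
    (a := 1 / 2) (b := 1 / 2) (by norm_num) (by norm_num) (by norm_num)
  have hhalf : (1 / 2 : ℝ) • p + (1 / 2 : ℝ) • z - midpoint ℝ y z = (1 / 2 : ℝ) • (p - y) := by
    rw [midpoint_eq_smul_add, invOf_eq_inv]; module
  rw [mem_ball, dist_eq_norm, hhalf, norm_smul, dist_right_midpoint, ← dist_eq_norm,
    dist_comm y z] at hmem
  norm_num at hmem
  linarith

theorem isTangentTo_of_sum_fderiv_fderiv_le [ProperSpace V] {ι : Type*} [Fintype ι]
    {U C : Set V} {φ : V → ℝ} {X : ι → V → V} (hU : IsOpen U)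
    (hφ : ContDiffOn ℝ 2 φ U) (hφ₀ : ∀ x ∈ U, 0 ≤ φ x) (hC : ∀ x ∈ U, x ∈ C ↔ φ x = 0)
    (hX : ∀ i, ContinuousOn (X i) U)
    (hK : ∀ z ∈ U, φ z = 0 → ∃ K : ℝ, ∀ᶠ x in 𝓝 z,
      ∑ i, fderiv ℝ (fderiv ℝ φ) x (X i x) (X i x) ≤ K * ‖fderiv ℝ φ x‖)
    (i : ι) : IsTangentTo U C (X i) := by
  intro z hz y hyU hy
  have hzU : U ∈ 𝓝 z := hU.mem_nhds (hyU (mem_closedBall'.2 le_rfl))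
  have hφz : φ z = 0 := (hC z (mem_of_mem_nhds hzU)).1 hz
  obtain ⟨K, hK⟩ := hK z (mem_of_mem_nhds hzU) hφz
  -- The ball with diameter `[y, z]` meets `C` only at `z`, as the strict comparison below needs.
  have hpos : ∀ p, dist p (midpoint ℝ y z) ≤ dist z (midpoint ℝ y z) → p ≠ z → 0 < φ p := by
    intro p hp hpz
    have hlt : dist p y < dist y z := dist_comm z y ▸ dist_lt_of_mem_closedBall_midpoint hp hpz
    have hpU : p ∈ U := hyU (mem_closedBall.2 hlt.le)
    have hpC : p ∉ C := notMem_of_dist_lt_infDist (by rwa [hy, dist_comm y p])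
    exact (hφ₀ p hpU).lt_of_ne' fun h => hpC ((hC p hpU).2 h)
  have hinner := inner_eq_zero_of_sum_fderiv_fderiv_le (hφ.contDiffAt hzU) hφz
    (mem_of_superset hzU hφ₀) (.of_forall hpos) (fun j => (hX j).continuousAt hzU) hK i
  have hmid : z - midpoint ℝ y z = -(1 / 2 : ℝ) • (y - z) := by
    rw [midpoint_eq_smul_add, invOf_eq_inv]; module
  rw [hmid, real_inner_smul_left, real_inner_comm] at hinner
  linarith

end Hopf

section Curvature

section InnerProductSpace

variable {V : Type*} [NormedAddCommGroup V] [InnerProductSpace ℝ V]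

/-- The divergence of the normalised field `G / |G|` at a point where `G` has the value `p ≠ 0`
and the derivative `A`. -/
noncomputable def normalizedTrace (p : V) (A : V →L[ℝ] V) : ℝ :=
  ‖p‖⁻¹ * (LinearMap.trace ℝ V A - (‖p‖ ^ 2)⁻¹ * inner ℝ p (A p))

theorem normalizedTrace_sub (p : V) (A B : V →L[ℝ] V) :
    normalizedTrace p (A - B) = normalizedTrace p A - normalizedTrace p B := by
  simp only [normalizedTrace, ContinuousLinearMap.toLinearMap_sub, map_sub,
    sub_apply, inner_sub_right]
  ring

theorem sum_inner_eq_norm_mul_normalizedTrace {ι : Type*} [Fintype ι] {p : V} (hp : p ≠ 0)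
    {X : ι → V} (hX : Orthonormal ℝ X)
    (hXp : Submodule.span ℝ (range X) = (Submodule.span ℝ {p})ᗮ) (A : V →L[ℝ] V) :
    ∑ i, inner ℝ (A (X i)) (X i) = ‖p‖ * normalizedTrace p A := by
  have hn : ‖p‖ ≠ 0 := norm_ne_zero_iff.2 hp
  have hperp (i : ι) : inner ℝ p (X i) = 0 :=
    Submodule.mem_orthogonal_singleton_iff_inner_right.1
      (hXp ▸ Submodule.subset_span (mem_range_self i))
  set f : Option ι → V := fun o => o.elim (‖p‖⁻¹ • p) X with hf
  have hfo : Orthonormal ℝ f := by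
    refine ⟨?_, ?_⟩
    · rintro (_ | i)
      · simp [hf, norm_smul, hn]
      · exact hX.1 i
    · rintro (_ | i) (_ | j) hij
      · exact absurd rfl hij
      · simp [hf, real_inner_smul_left, hperp]
      · simp [hf, real_inner_smul_right, real_inner_comm, hperp]
      · exact hX.2 fun h => hij (congrArg some h)
  have hspan : ⊤ ≤ Submodule.span ℝ (range f) := by
    rw [hf, Option.range_elim, Submodule.span_insert]
    rw [hXp, Submodule.span_singleton_smul_eq (inv_ne_zero hn).isUnit,
      Submodule.sup_orthogonal_of_hasOrthogonalProjection]
  have htrace := LinearMap.trace_eq_sum_inner (A : V →ₗ[ℝ] V) (OrthonormalBasis.mk hfo hspan)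
  simp only [OrthonormalBasis.coe_mk, hf, Fintype.sum_option, Option.elim_none, Option.elim_some,
    ContinuousLinearMap.coe_coe, map_smul, real_inner_smul_left, real_inner_smul_right] at htrace
  rw [normalizedTrace, htrace, mul_inv_cancel_left₀ hn]
  simp only [real_inner_comm]
  ring

variable [FiniteDimensional ℝ V]

theorem trace_fderiv_inv_norm_smul {G : V → V} {A : V →L[ℝ] V} {x : V} (hG : HasFDerivAt G A x)
    (hx : G x ≠ 0) :
    LinearMap.trace ℝ V (fderiv ℝ (fun y => ‖G y‖⁻¹ • G y) x) = normalizedTrace (G x) A := by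
  have hn : ‖G x‖ ≠ 0 := norm_ne_zero_iff.2 hx
  have hnorm : HasFDerivAt (fun y => √(‖G y‖ ^ 2)) _ x := hG.norm_sq.sqrt (by positivity)
  simp only [Real.sqrt_sq (norm_nonneg _)] at hnorm
  have hinv : HasFDerivAt (fun y => ‖G y‖⁻¹) (-(‖G x‖ ^ 3)⁻¹ • (innerSL ℝ (G x) ∘L A)) x := by
    refine ((hasDerivAt_inv hn).comp_hasFDerivAt x hnorm).congr_fderiv ?_
    ext w
    simp only [smul_apply, smul_eq_mul, nsmul_eq_mul]
    push_cast
    field_simp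
  rw [(hinv.fun_smul hG).fderiv, ContinuousLinearMap.toLinearMap_add, map_add,
    ContinuousLinearMap.toLinearMap_smul, map_smul, ContinuousLinearMap.coe_smulRight,
    LinearMap.trace_smulRight, ContinuousLinearMap.coe_coe, smul_apply,
    ContinuousLinearMap.comp_apply, innerSL_apply_apply, normalizedTrace, smul_eq_mul, smul_eq_mul]
  field_simp
  ring

theorem contDiffAt_normalizedTrace {p : V} (hp : p ≠ 0) (A : V →L[ℝ] V) {n : ℕ∞} :
    ContDiffAt ℝ n (fun q : V × (V →L[ℝ] V) => normalizedTrace q.1 q.2) (p, A) := by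
  have hp' : ‖p‖ ≠ 0 := norm_ne_zero_iff.2 hp
  have hfst : ContDiffAt ℝ n (fun q : V × (V →L[ℝ] V) => q.1) (p, A) := contDiffAt_fst
  have hsnd : ContDiffAt ℝ n (fun q : V × (V →L[ℝ] V) => q.2) (p, A) := contDiffAt_snd
  have hnorm : ContDiffAt ℝ n (fun q : V × (V →L[ℝ] V) => ‖q.1‖) (p, A) := hfst.norm ℝ hp
  have htrace : ContDiff ℝ n fun B : V →L[ℝ] V => LinearMap.trace ℝ V B :=
    (LinearMap.toContinuousLinearMap
      (LinearMap.trace ℝ V ∘ₗ ContinuousLinearMap.coeLM ℝ)).contDiff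
  exact (hnorm.inv hp').mul ((htrace.contDiffAt.comp _ hsnd).sub
    (((hnorm.pow 2).inv (pow_ne_zero 2 hp')).mul (hfst.inner ℝ (hsnd.clm_apply hfst))))

theorem exists_abs_normalizedTrace_sub_le {α : Type*} [TopologicalSpace α] {p q : α → V}
    {A : α → V →L[ℝ] V} {z : α} (hp : ContinuousAt p z) (hq : ContinuousAt q z)
    (hA : ContinuousAt A z) (hpq : p z = q z) (hz : p z ≠ 0) :
    ∃ L : ℝ, 0 ≤ L ∧ ∀ᶠ x in 𝓝 z,
      |normalizedTrace (p x) (A x) - normalizedTrace (q x) (A x)| ≤ L * dist (p x) (q x) := by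
  obtain ⟨L, S, hS, hL⟩ :=
    (contDiffAt_normalizedTrace hz (A z) (n := 1)).exists_lipschitzOnWith
  have hpA : ∀ᶠ x in 𝓝 z, (p x, A x) ∈ S := (hp.prodMk hA).preimage_mem_nhds hS
  have hqA : ∀ᶠ x in 𝓝 z, (q x, A x) ∈ S := (hq.prodMk hA).preimage_mem_nhds (hpq ▸ hS)
  refine ⟨L, L.2, ?_⟩
  filter_upwards [hpA, hqA] with x hpx hqx
  simpa [Real.dist_eq, Prod.dist_eq] using hL.dist_le_mul _ hpx _ hqx

theorem exists_normalizedTrace_lineMap_sub_le {α : Type*} [TopologicalSpace α] {p q : α → V}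
    {A B : α → V →L[ℝ] V} {z : α} (hp : ContinuousAt p z) (hq : ContinuousAt q z)
    (hA : ContinuousAt A z) (hB : ContinuousAt B z) (hpq : p z = q z) (hz : p z ≠ 0)
    (hle : ∀ᶠ x in 𝓝 z, normalizedTrace (q x) (B x) ≤ normalizedTrace (p x) (A x)) (θ : ℝ) :
    ∃ L : ℝ, 0 ≤ L ∧ ∀ᶠ x in 𝓝 z,
      normalizedTrace (AffineMap.lineMap (p x) (q x) θ) (B x - A x) ≤ L * dist (p x) (q x) := by
  set r : α → V := fun x => AffineMap.lineMap (p x) (q x) θ with hr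
  have hrz : r z = p z := by simp [hr, ← hpq]
  have hrc : ContinuousAt r z := hp.lineMap hq continuousAt_const
  obtain ⟨Lq, hLq₀, hLq⟩ := exists_abs_normalizedTrace_sub_le hrc hq hB (hrz.trans hpq) (hrz ▸ hz)
  obtain ⟨Lp, hLp₀, hLp⟩ := exists_abs_normalizedTrace_sub_le hrc hp hA hrz (hrz ▸ hz)
  refine ⟨Lq * ‖1 - θ‖ + Lp * ‖θ‖, by positivity, ?_⟩
  filter_upwards [hLq, hLp, hle] with x hqx hpx hlex
  rw [hr, dist_lineMap_right] at hqx
  rw [hr, dist_lineMap_left] at hpx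
  rw [normalizedTrace_sub]
  linarith [(abs_le.1 hqx).2, (abs_le.1 hpx).1]

theorem exists_sum_inner_sub_le {α ι : Type*} [TopologicalSpace α] [Fintype ι] {p q : α → V}
    {A B : α → V →L[ℝ] V} {X : ι → α → V} {z : α} (hp : ContinuousAt p z) (hq : ContinuousAt q z)
    (hA : ContinuousAt A z) (hB : ContinuousAt B z) (hpq : p z = q z) (hz : p z ≠ 0)
    (hle : ∀ᶠ x in 𝓝 z, normalizedTrace (q x) (B x) ≤ normalizedTrace (p x) (A x)) {θ : ℝ}
    (hX : ∀ᶠ x in 𝓝 z, Orthonormal ℝ (X · x) ∧ Submodule.span ℝ (range (X · x)) =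
      (Submodule.span ℝ {AffineMap.lineMap (p x) (q x) θ})ᗮ) :
    ∃ K : ℝ, ∀ᶠ x in 𝓝 z, ∑ i, inner ℝ ((B x - A x) (X i x)) (X i x) ≤ K * dist (p x) (q x) := by
  obtain ⟨L, hL₀, hL⟩ := exists_normalizedTrace_lineMap_sub_le hp hq hA hB hpq hz hle θ
  set r : α → V := fun x => AffineMap.lineMap (p x) (q x) θ with hr
  have hrz : r z ≠ 0 := by simpa [hr, ← hpq] using hz
  have hrc : ContinuousAt r z := hp.lineMap hq continuousAt_const
  refine ⟨(‖r z‖ + 1) * L, ?_⟩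
  filter_upwards [hL, hX, hrc.eventually_ne hrz, hrc.norm.eventually_le_const (lt_add_one _)]
    with x hLx ⟨hXo, hXs⟩ hrx hrx'
  calc ∑ i, inner ℝ ((B x - A x) (X i x)) (X i x)
      = ‖r x‖ * normalizedTrace (r x) (B x - A x) :=
        sum_inner_eq_norm_mul_normalizedTrace hrx hXo hXs _
    _ ≤ ‖r x‖ * (L * dist (p x) (q x)) := by gcongr
    _ ≤ (‖r z‖ + 1) * (L * dist (p x) (q x)) := by gcongr
    _ = (‖r z‖ + 1) * L * dist (p x) (q x) := by ring

end InnerProductSpace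

section Gradient

variable {V : Type*} [NormedAddCommGroup V] [InnerProductSpace ℝ V] [CompleteSpace V]
  {f g : V → ℝ} {x : V}

theorem contDiffAt_gradient {n k : ℕ∞} (hf : ContDiffAt ℝ n f x) (hk : k + 1 ≤ n) :
    ContDiffAt ℝ k (gradient f) x :=
  (InnerProductSpace.toDual ℝ V).symm.contDiff.contDiffAt.comp x
    (hf.fderiv_right (by exact_mod_cast hk))

theorem norm_gradient (f : V → ℝ) (x : V) : ‖gradient f x‖ = ‖fderiv ℝ f x‖ :=
  LinearIsometryEquiv.norm_map _ _

theorem gradient_sub (hf : DifferentiableAt ℝ f x) (hg : DifferentiableAt ℝ g x) :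
    gradient (f - g) x = gradient f x - gradient g x := by
  rw [gradient, fderiv_sub hf hg, map_sub, gradient, gradient]

theorem gradient_lineMap (hf : DifferentiableAt ℝ f x) (hg : DifferentiableAt ℝ g x) (θ : ℝ) :
    gradient (AffineMap.lineMap f g θ) x =
      AffineMap.lineMap (gradient f x) (gradient g x) θ := by
  rw [AffineMap.lineMap_apply_module, AffineMap.lineMap_apply_module, gradient,
    fderiv_add (hf.const_smul _) (hg.const_smul _), fderiv_const_smul hf, fderiv_const_smul hg,
    map_add, map_smul, map_smul]
  rfl

theorem inner_fderiv_gradient (hf : ContDiffAt ℝ 2 f x) (w w' : V) :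
    inner ℝ (fderiv ℝ (gradient f) x w) w' = fderiv ℝ (fderiv ℝ f) x w w' := by
  have hgrad : DifferentiableAt ℝ (gradient f) x :=
    (contDiffAt_gradient hf (k := 1) le_rfl).differentiableAt one_ne_zero
  have hfderiv : DifferentiableAt ℝ (fderiv ℝ f) x :=
    (hf.fderiv_right (m := 1) le_rfl).differentiableAt one_ne_zero
  have hinner : (fun y => inner ℝ (gradient f y) w') = fun y => fderiv ℝ f y w' :=
    funext fun _ => inner_gradient_left
  have := congrArg (fun h => fderiv ℝ h x w) hinner
  rw [fderiv_inner_apply ℝ hgrad (differentiableAt_const w'),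
    fderiv_clm_apply hfderiv (differentiableAt_const w')] at this
  simpa using this

end Gradient

section HorizontalGradient

variable {m : ℕ} {F : E m → E m} {u v : E m → ℝ} {x : E m}

/-- The horizontal gradient `∇u + F`, of which the horizontal normal is the normalisation. -/
noncomputable def horizontalGradient (F : E m → E m) (u : E m → ℝ) (x : E m) : E m :=
  gradient u x + F x

theorem contDiffAt_horizontalGradient (hF : ContDiffAt ℝ 1 F x) (hu : ContDiffAt ℝ 2 u x) :
    ContDiffAt ℝ 1 (horizontalGradient F u) x :=
  (contDiffAt_gradient hu (k := 1) le_rfl).add hF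

theorem horizontalGradient_lineMap (hu : DifferentiableAt ℝ u x) (hv : DifferentiableAt ℝ v x)
    (θ : ℝ) : horizontalGradient F (AffineMap.lineMap u v θ) x =
      AffineMap.lineMap (horizontalGradient F u x) (horizontalGradient F v x) θ := by
  rw [horizontalGradient, gradient_lineMap hu hv, horizontalGradient, horizontalGradient,
    AffineMap.lineMap_apply_module, AffineMap.lineMap_apply_module]
  module

theorem gradient_sub_eq_horizontalGradient_sub (F : E m → E m) (hu : DifferentiableAt ℝ u x)
    (hv : DifferentiableAt ℝ v x) :
    gradient (v - u) x = horizontalGradient F v x - horizontalGradient F u x := by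
  rw [gradient_sub hv hu, horizontalGradient, horizontalGradient, add_sub_add_right_eq_sub]

theorem dist_horizontalGradient (F : E m → E m) (hu : DifferentiableAt ℝ u x)
    (hv : DifferentiableAt ℝ v x) :
    dist (horizontalGradient F u x) (horizontalGradient F v x) = ‖fderiv ℝ (v - u) x‖ := by
  rw [dist_comm, dist_eq_norm, ← gradient_sub_eq_horizontalGradient_sub F hu hv, norm_gradient]

theorem inner_fderiv_horizontalGradient_sub (hF : ContDiffAt ℝ 1 F x) (hu : ContDiffAt ℝ 2 u x)
    (hv : ContDiffAt ℝ 2 v x) (w w' : E m) :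
    inner ℝ ((fderiv ℝ (horizontalGradient F v) x - fderiv ℝ (horizontalGradient F u) x) w) w' =
      fderiv ℝ (fderiv ℝ (v - u)) x w w' := by
  have hsub : gradient (v - u) =ᶠ[𝓝 x] horizontalGradient F v - horizontalGradient F u := by
    filter_upwards [hu.eventually (by simp), hv.eventually (by simp)] with y huy hvy
    exact gradient_sub_eq_horizontalGradient_sub F (huy.differentiableAt two_ne_zero)
      (hvy.differentiableAt two_ne_zero)
  rw [← inner_fderiv_gradient (f := v - u) (hv.sub hu), hsub.fderiv_eq,
    fderiv_sub ((contDiffAt_horizontalGradient hF hv).differentiableAt one_ne_zero)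
      ((contDiffAt_horizontalGradient hF hu).differentiableAt one_ne_zero)]

theorem divergence_eq_trace (W : E m → E m) (x : E m) :
    divergence W x = LinearMap.trace ℝ (E m) (fderiv ℝ W x) := by
  rw [LinearMap.trace_eq_sum_inner _ (EuclideanSpace.basisFun (Fin m) ℝ)]
  simp [divergence, EuclideanSpace.inner_single_left]

theorem horizontalMeanCurvature_eq_normalizedTrace
    (hF : ContDiffAt ℝ 1 F x) (hu : ContDiffAt ℝ 2 u x) (hx : Nonsingular F u x) :
    horizontalMeanCurvature F u x =
      normalizedTrace (horizontalGradient F u x) (fderiv ℝ (horizontalGradient F u) x) := by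
  rw [horizontalMeanCurvature, divergence_eq_trace]
  exact trace_fderiv_inv_norm_smul
    ((contDiffAt_horizontalGradient hF hu).differentiableAt one_ne_zero).hasFDerivAt hx

theorem span_horizontalNormal (hx : Nonsingular F u x) :
    Submodule.span ℝ {horizontalNormal F u x} = Submodule.span ℝ {horizontalGradient F u x} :=
  Submodule.span_singleton_smul_eq (inv_ne_zero (norm_ne_zero_iff.2 hx)).isUnit _

theorem exists_sum_fderiv_fderiv_sub_le {ι : Type*} [Fintype ι] {X : ι → E m → E m} {z : E m}
    (hF : ContDiffAt ℝ 1 F z) (hu : ContDiffAt ℝ 2 u z) (hv : ContDiffAt ℝ 2 v z)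
    (hgrad : gradient u z = gradient v z) (hz : Nonsingular F u z)
    (hH : ∀ᶠ x in 𝓝 z, Nonsingular F u x → Nonsingular F v x →
      horizontalMeanCurvature F v x ≤ horizontalMeanCurvature F u x) {θ : ℝ}
    (hX : ∀ᶠ x in 𝓝 z, Orthonormal ℝ (X · x) ∧ Submodule.span ℝ (range (X · x)) =
      (Submodule.span ℝ {horizontalGradient F (AffineMap.lineMap u v θ) x})ᗮ) :
    ∃ K : ℝ, ∀ᶠ x in 𝓝 z, ∑ i, fderiv ℝ (fderiv ℝ (v - u)) x (X i x) (X i x) ≤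
      K * ‖fderiv ℝ (v - u) x‖ := by
  have hC2 : ∀ᶠ x in 𝓝 z, ContDiffAt ℝ 2 u x ∧ ContDiffAt ℝ 2 v x :=
    (hu.eventually (by simp)).and (hv.eventually (by simp))
  have hGu := contDiffAt_horizontalGradient hF hu
  have hGv := contDiffAt_horizontalGradient hF hv
  have hGz : horizontalGradient F u z = horizontalGradient F v z :=
    congrArg (· + F z) hgrad
  have hcurv : ∀ᶠ x in 𝓝 z,
      normalizedTrace (horizontalGradient F v x) (fderiv ℝ (horizontalGradient F v) x) ≤
        normalizedTrace (horizontalGradient F u x) (fderiv ℝ (horizontalGradient F u) x) := by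
    filter_upwards [hC2, hF.eventually (by simp), hH, hGu.continuousAt.eventually_ne hz,
      hGv.continuousAt.eventually_ne (ne_of_eq_of_ne hGz.symm hz)] with x ⟨hux, hvx⟩ hFx hHx hnu hnv
    rw [← horizontalMeanCurvature_eq_normalizedTrace hFx hux hnu,
      ← horizontalMeanCurvature_eq_normalizedTrace hFx hvx hnv]
    exact hHx hnu hnv
  obtain ⟨K, hK⟩ := exists_sum_inner_sub_le (X := X) (θ := θ) hGu.continuousAt hGv.continuousAt
    (hGu.fderiv_right (m := 0) le_rfl).continuousAt (hGv.fderiv_right (m := 0) le_rfl).continuousAt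
    hGz hz hcurv (by
      filter_upwards [hX, hC2] with x hXx hx
      rwa [← horizontalGradient_lineMap (hx.1.differentiableAt two_ne_zero)
        (hx.2.differentiableAt two_ne_zero)])
  refine ⟨K, ?_⟩
  filter_upwards [hK, hC2, hF.eventually (by simp)] with x hKx ⟨hux, hvx⟩ hFx
  simpa only [inner_fderiv_horizontalGradient_sub hFx hux hvx, dist_horizontalGradient F
    (hux.differentiableAt two_ne_zero) (hvx.differentiableAt two_ne_zero)] using hKx

theorem isTangentTo_contactSet {ι : Type*} [Finite ι] {U C : Set (E m)} {X : ι → E m → E m}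
    (hU : IsOpen U) (hF : ContDiffOn ℝ 1 F U) (hu : ContDiffOn ℝ 2 u U) (hv : ContDiffOn ℝ 2 v U)
    {θ : ℝ} (hw : ∀ x ∈ U, Nonsingular F (AffineMap.lineMap u v θ) x)
    (hH : ∀ x ∈ U, Nonsingular F u x → Nonsingular F v x →
      horizontalMeanCurvature F v x ≤ horizontalMeanCurvature F u x)
    (hvu : ∀ x ∈ U, u x ≤ v x) (hC : ∀ x ∈ U, x ∈ C ↔ (v - u) x = 0)
    (hX : ∀ i, ContinuousOn (X i) U)
    (hXw : ∀ x ∈ U, Orthonormal ℝ (X · x) ∧ Submodule.span ℝ (range (X · x)) =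
      (Submodule.span ℝ {horizontalNormal F (AffineMap.lineMap u v θ) x})ᗮ) (i : ι) :
    IsTangentTo U C (X i) := by
  cases nonempty_fintype ι
  refine isTangentTo_of_sum_fderiv_fderiv_le hU (hv.sub hu)
    (fun x hx => sub_nonneg.2 (hvu x hx)) hC hX (fun z hz hz₀ => ?_) i
  have hUz : U ∈ 𝓝 z := hU.mem_nhds hz
  have huz := (hu.contDiffAt hUz).differentiableAt two_ne_zero
  have hvz := (hv.contDiffAt hUz).differentiableAt two_ne_zero
  have hmin : IsLocalMin (v - u) z := by
    filter_upwards [hUz] with y hy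
    exact hz₀.trans_le (sub_nonneg.2 (hvu y hy))
  have hgrad : gradient u z = gradient v z := by
    rw [eq_comm, ← sub_eq_zero, ← gradient_sub hvz huz, gradient, hmin.fderiv_eq_zero, map_zero]
  have hnu : Nonsingular F u z := by
    have := hw z hz
    rwa [Nonsingular, gradient_lineMap huz hvz, ← hgrad, AffineMap.lineMap_same_apply] at this
  refine exists_sum_fderiv_fderiv_sub_le (θ := θ) (hF.contDiffAt hUz) (hu.contDiffAt hUz)
    (hv.contDiffAt hUz) hgrad hnu (mem_of_superset hUz hH) ?_
  filter_upwards [hUz] with x hx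
  rw [← span_horizontalNormal (hw x hx)]
  exact hXw x hx

end HorizontalGradient

end Curvature

end HorizontalCurvature

open HorizontalCurvature in
theorem theoremF_general {m : ℕ} {U : Set (EuclideanSpace ℝ (Fin m))} (hUo : IsOpen U)
    (hUc : IsPreconnected U) {F : EuclideanSpace ℝ (Fin m) → EuclideanSpace ℝ (Fin m)}
    (hF : ContDiffOn ℝ 1 F U) {u v : EuclideanSpace ℝ (Fin m) → ℝ} (hu : ContDiffOn ℝ 2 u U)
    (hv : ContDiffOn ℝ 2 v U)
    (hH : ∀ x ∈ U, Nonsingular F u x → Nonsingular F v x →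
      horizontalMeanCurvature F v x ≤ horizontalMeanCurvature F u x)
    (hvu : ∀ x ∈ U, u x ≤ v x) {p₀ : EuclideanSpace ℝ (Fin m)} (hp₀ : p₀ ∈ U)
    (heq : v p₀ = u p₀) {θ : ℝ} (hw : ∀ x ∈ U, Nonsingular F (AffineMap.lineMap u v θ) x)
    (hframe : HasFullRankNormalFrame U F (AffineMap.lineMap u v θ)) :
    ∀ x ∈ U, v x = u x := by
  obtain ⟨X, ⟨hX, hXw⟩, hrank⟩ := hframe
  obtain ⟨C, hC, hCU⟩ :=
    continuousOn_iff_isClosed.1 (hv.sub hu).continuousOn {0} isClosed_singleton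
  have hmem : ∀ x ∈ U, x ∈ C ↔ (v - u) x = 0 := fun x hx => by
    simpa [hx, iff_comm] using Set.ext_iff.1 hCU x
  have htan : ∀ i, IsTangentTo U C (X i) :=
    isTangentTo_contactSet hUo hF hu hv hw hH hvu hmem (fun i => (hX i).continuousOn) hXw
  have hsub : U ⊆ C := subset_of_isTangentTo_of_lieRank hUo hUc hC htan hrank
    ⟨p₀, hp₀, (hmem p₀ hp₀).2 (sub_eq_zero.2 heq)⟩
  exact fun x hx => sub_eq_zero.1 ((hmem x hx).1 (hsub hx))

theorem theoremF (m : ℕ) (hm : 3 ≤ m)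
    (U : Set (EuclideanSpace ℝ (Fin m))) (hUo : IsOpen U) (hUc : IsConnected U)
    (F : EuclideanSpace ℝ (Fin m) → EuclideanSpace ℝ (Fin m)) (hF : ContDiffOn ℝ 1 F U)
    (u v : EuclideanSpace ℝ (Fin m) → ℝ)
    (hu : ContDiffOn ℝ 2 u U) (hv : ContDiffOn ℝ 2 v U)
    (hnu : ∀ x ∈ U, HorizontalCurvature.Nonsingular F u x)
    (hnv : ∀ x ∈ U, HorizontalCurvature.Nonsingular F v x)
    (hH : ∀ x ∈ U, HorizontalCurvature.horizontalMeanCurvature F v x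
      ≤ HorizontalCurvature.horizontalMeanCurvature F u x)
    (hvu : ∀ x ∈ U, u x ≤ v x)
    (p₀ : EuclideanSpace ℝ (Fin m)) (hp₀ : p₀ ∈ U) (heq : v p₀ = u p₀)
    (hframe : HorizontalCurvature.HasFullRankNormalFrame U F u ∨
      HorizontalCurvature.HasFullRankNormalFrame U F v) :
    ∀ x ∈ U, v x = u x := by
  rcases hframe with hframe | hframe
  · exact theoremF_general (θ := 0) hUo hUc.isPreconnected hF hu hv (fun x hx _ _ => hH x hx)
      hvu hp₀ heq (by simpa using hnu) (by simpa using hframe)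
  · exact theoremF_general (θ := 1) hUo hUc.isPreconnected hF hu hv (fun x hx _ _ => hH x hx)
      hvu hp₀ heq (by simpa using hnv) (by simpa using hframe)
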